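/- Let $G$ be a locally compact (Hausdorff) group, $H$ a closed subgroup of $G$ and $L$ a closed subgroup of $H$. For a locally compact group $K$ let $\Delta_K$ be its modular function, normalised by $\int_K \phi(y)\,dy=\Delta_K(x)\int_K \phi(yx)\,dy$ for $\phi\in C_c(K)$, with respect to left Haar measure, and assume that $\Delta_G|_L=\Delta_H|_L=\Delta_L$. Let $\rho_{G,H}$ be an arbitrary rho-function for the pair $(G,H)$, that is, a non-negative function $\rho:G\to\mathbb{R}$, locally integrable with respect to Haar measure, such that $\rho(xh)=\Delta_H(h)\Delta_G(h)^{-1}\rho(x)$ for all $x\in G$, $h\in H$. Since $\Delta_G=\Delta_H$ on $L$, it defines a function $\rho_{G,H}(xL):=\rho_{G,H}(x)$ on $G/L$. Let $\nu$ be a $G$-invariant Radon measure on $G/L$ and $\eta$ a nonzero $H$-invariant Radon measure on $H/L$, and for $f\in C_c(G/L)$ (complex-valued) put $$R_{L,H}f(xH)=\int_{H/L} f(xhL)\,d\eta(hL)\qquad(xH\in G/H).$$ If $f\in C_c(G/L)$ and $R_{L,H}f=0$, then $xL\mapsto\rho_{G,H}(xL)f(xL)$ is $\nu$-integrable and $$\int_{G/L}\rho_{G,H}(xL)\,f(xL)\,d\nu(xL)=0.$$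 -/

import Mathlib

open MeasureTheory
open scoped NNReal CompactlySupported

namespace QuotientIntegral

/-- The modular function `Δ_G` of a locally compact group, normalised by
`∫ f(y) dy = Δ_G(x) ∫ f(yx) dy` (left Haar measure). Mathlib's `modularCharacter`
is normalised the other way round, hence the inverse; see `integral_eq_modularFunction_mul`. -/
noncomputable def modularFunction (G : Type*) [Group G] [TopologicalSpace G]
    [IsTopologicalGroup G] [LocallyCompactSpace G] (x : G) : ℝ :=
  (((Measure.modularCharacter x)⁻¹ : ℝ≥0) : ℝ)

/-- The defining identity of the modular function, in the normalisation used here. -/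
theorem integral_eq_modularFunction_mul {G : Type*} [Group G] [TopologicalSpace G]
    [IsTopologicalGroup G] [LocallyCompactSpace G] [MeasurableSpace G] [BorelSpace G]
    (μ : Measure G) [μ.IsHaarMeasure] (f : C_c(G, ℝ)) (x : G) :
    ∫ y, f y ∂μ = modularFunction G x * ∫ y, f (y * x) ∂μ := by
  have hpos : (0 : ℝ) < (Measure.modularCharacterFun x : ℝ) := by
    exact_mod_cast Measure.modularCharacterFun_pos x
  have h1 : ∫ y, f (y * x) ∂μ = ∫ y, f y ∂(Measure.map (· * x) μ) := by
    exact (integral_map (AEMeasurable.mul_const aemeasurable_id' _)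
      f.continuous.aestronglyMeasurable).symm
  have h2 : ∫ y, f y ∂(Measure.map (· * x) μ)
      = (Measure.modularCharacterFun x : ℝ) * ∫ y, f y ∂μ := by
    rw [Measure.modularCharacterFun_eq_haarScalarFactor μ x]
    have h := Measure.integral_isMulLeftInvariant_eq_smul_of_hasCompactSupport
        (Measure.map (· * x) μ) μ f.continuous f.hasCompactSupport
    rw [integral_smul_nnreal_measure] at h
    exact h
  have h3 : modularFunction G x = (Measure.modularCharacterFun x : ℝ)⁻¹ := by
    simp [modularFunction, Measure.modularCharacter]
  rw [h1, h2, h3, inv_mul_cancel_left₀ hpos.ne']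

section

variable {G : Type*} [Group G] [TopologicalSpace G] [IsTopologicalGroup G]
  [LocallyCompactSpace G]

/-- The modular function `Δ_H` of a closed subgroup `H` (which is itself a locally compact
group). -/
noncomputable def subgroupModularFunction (H : Subgroup G) (hH : IsClosed (H : Set G)) (h : H) :
    ℝ :=
  haveI : LocallyCompactSpace H := hH.isClosedEmbedding_subtypeVal.locallyCompactSpace
  modularFunction H h

/-- Rho-functions for the pair `(G, H)`: non-negative locally integrable functions on `G` with
`ρ(xh) = Δ_H(h) Δ_G(h)⁻¹ ρ(x)`. -/
structure IsRhoFunction [MeasurableSpace G] [BorelSpace G] (H : Subgroup G)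
    (hH : IsClosed (H : Set G)) (ρ : G → ℝ) : Prop where
  nonneg : ∀ x, 0 ≤ ρ x
  locallyIntegrable : LocallyIntegrable ρ (Measure.haar : Measure G)
  map_mul : ∀ (x : G) (h : H),
    ρ (x * h) = subgroupModularFunction H hH h * (modularFunction G (h : G))⁻¹ * ρ x

theorem IsRhoFunction.map_mul_of_modular [MeasurableSpace G] [BorelSpace G] {H L : Subgroup G}
    {hH : IsClosed (H : Set G)} {ρ : G → ℝ} (hρ : IsRhoFunction H hH ρ) (hLH : L ≤ H)
    (hΔ : ∀ l : L, modularFunction G (l : G) =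
      subgroupModularFunction H hH ⟨(l : G), hLH l.2⟩)
    (x l : G) (hl : l ∈ L) : ρ (x * l) = ρ x := by
  have h0 : modularFunction G l ≠ 0 := by
    have := (Measure.modularCharacterFun_pos l).ne'
    simpa [modularFunction, Measure.modularCharacter] using this
  have h1 := hρ.map_mul x ⟨l, hLH hl⟩
  have h2 := hΔ ⟨l, hl⟩
  simp only at h1 h2
  rw [h1, ← h2, mul_inv_cancel₀ h0, one_mul]

end

section

variable {G : Type*} [Group G]

/-- The function `xL ↦ ρ(x)` on `G/L`, for a function `ρ` on `G` that is right `L`-invariant. -/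
def onQuotient {β : Type*} (L : Subgroup G) (ρ : G → β)
    (hρ : ∀ x l : G, l ∈ L → ρ (x * l) = ρ x) : G ⧸ L → β :=
  Quotient.lift ρ fun a b hab => by
    have hab' : a⁻¹ * b ∈ L := QuotientGroup.leftRel_apply.mp hab
    have := hρ a (a⁻¹ * b) hab'
    rwa [mul_inv_cancel_left, eq_comm] at this

@[simp] theorem onQuotient_mk {β : Type*} (L : Subgroup G) (ρ : G → β)
    (hρ : ∀ x l : G, l ∈ L → ρ (x * l) = ρ x) (x : G) :
    onQuotient L ρ hρ (x : G ⧸ L) = ρ x := rfl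

/-- The function `xL ↦ ρ(x)` on `G/L` for a rho-function `ρ` for `(G, H)`; it is well defined
when `L ≤ H` and `Δ_G = Δ_H` on `L`. -/
def rhoQuotient [TopologicalSpace G] [IsTopologicalGroup G] [LocallyCompactSpace G]
    [MeasurableSpace G] [BorelSpace G] {H L : Subgroup G} {hH : IsClosed (H : Set G)} {ρ : G → ℝ}
    (hρ : IsRhoFunction H hH ρ) (hLH : L ≤ H)
    (hΔ : ∀ l : L, modularFunction G (l : G) =
      subgroupModularFunction H hH ⟨(l : G), hLH l.2⟩) : G ⧸ L → ℝ :=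
  onQuotient L ρ (hρ.map_mul_of_modular hLH hΔ)

/-- The map `H/L → G/L`, `hL ↦ xhL`. -/
def fiberMap (H L : Subgroup G) (x : G) : H ⧸ L.subgroupOf H → G ⧸ L :=
  Quotient.lift (fun h : H => ((x * (h : G) : G) : G ⧸ L)) fun a b hab => by
    have hab' : a⁻¹ * b ∈ L.subgroupOf H := QuotientGroup.leftRel_apply.mp hab
    rw [Subgroup.mem_subgroupOf] at hab'
    refine QuotientGroup.eq.mpr ?_
    simpa [mul_assoc] using hab'

@[simp] theorem fiberMap_mk (H L : Subgroup G) (x : G) (h : H) :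
    fiberMap H L x (h : H ⧸ L.subgroupOf H) = ((x * (h : G) : G) : G ⧸ L) := rfl

theorem fiberMap_mul (H L : Subgroup G) (x : G) (k : H) (q : H ⧸ L.subgroupOf H) :
    fiberMap H L (x * (k : G)) q = fiberMap H L x (k • q) := by
  induction q using QuotientGroup.induction_on with
  | H h =>
    have : k • (h : H ⧸ L.subgroupOf H) = ((k * h : H) : H ⧸ L.subgroupOf H) := rfl
    rw [this, fiberMap_mk, fiberMap_mk, Subgroup.coe_mul, mul_assoc]

variable [TopologicalSpace G] [IsTopologicalGroup G]

/-- The Radon transform `R_{L,H} f (xH) = ∫_{H/L} f(xhL) dη(hL)` with respect to an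
`H`-invariant Borel measure `η` on `H/L`, as a function on `G/H`. -/
noncomputable def radonTransform (H L : Subgroup G)
    [MeasurableSpace (H ⧸ L.subgroupOf H)] [BorelSpace (H ⧸ L.subgroupOf H)]
    (η : Measure (H ⧸ L.subgroupOf H)) [SMulInvariantMeasure H (H ⧸ L.subgroupOf H) η]
    (f : C_c(G ⧸ L, ℂ)) : G ⧸ H → ℂ :=
  onQuotient H (fun x => ∫ q, f (fiberMap H L x q) ∂η) fun x k hk => by
    have h := integral_smul_eq_self (μ := η) (fun q => f (fiberMap H L x q)) (g := (⟨k, hk⟩ : H))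
    rw [← h]
    refine integral_congr_ae (Filter.Eventually.of_forall fun q => ?_)
    exact congrArg f (fiberMap_mul H L x ⟨k, hk⟩ q)

@[simp] theorem radonTransform_mk (H L : Subgroup G)
    [MeasurableSpace (H ⧸ L.subgroupOf H)] [BorelSpace (H ⧸ L.subgroupOf H)]
    (η : Measure (H ⧸ L.subgroupOf H)) [SMulInvariantMeasure H (H ⧸ L.subgroupOf H) η]
    (f : C_c(G ⧸ L, ℂ)) (x : G) :
    radonTransform H L η f (x : G ⧸ H) = ∫ q, f (fiberMap H L x q) ∂η := rfl

end

end QuotientIntegral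

open QuotientIntegral

namespace QuotientIntegral

open Filter Topology Set
open scoped Pointwise ENNReal

set_option linter.unusedSectionVars false
set_option linter.style.haveILetI false

/-! Fix Haar measures on `L`, `H` and `G`, and write `f` (real, after splitting) as the fibre
integral over `L` of φ(x) = f(xL) ψ(x), where ψ is a cutoff with fibre integral 1 over the support
of `f`. Weil's formula on `H/L`, whose constant is nonzero because η ≠ 0, turns the vanishing of the
Radon transform into ∫_H φ(xh) dh = 0 for every x. Weil's formula on `G/L`, applied to ρφ, turns the
integral of ρf against ν into a multiple of ∫_G ρφ. It remains to see that ρ annihilates every φ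
whose integrals over the cosets of `H` vanish.

For this take g in C_c(G) with ∫_H g(xh) dh = 1 on supp φ, insert this factor, exchange the
integrals and substitute x = yh⁻¹. The Δ_G-factors cancel against the transformation rule of ρ,
leaving ∫_G ρ(y) g(y) ∫_H Δ_H(h)⁻¹ φ(yh⁻¹) dh dy. By inversion on `H` the inner integral is a
multiple of ∫_H φ(yh) dh = 0.

Two points need care, since ρ is only locally integrable and `G` need not be σ-compact. The exchange
of integrals uses the Radon measure σ = ρ dx given by the Riesz theorem, so that the integrands are
continuous with compact support (`IsRhoFunction.integral_mul_eq_zero`). Weil's formula for the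
discontinuous ρψ comes from an a.e. convergent series in C_c(G), together with the fact that almost
every fibre of a null set is null (`integrable_mul_fiberIntegral`, `ae_measure_fiber_eq_zero`). -/

/-- A parametric integral is continuous if the integrand is continuous and compactly supported
locally uniformly in the parameter. -/
theorem continuous_integral_of_locally_compact_support {X Y : Type*} [TopologicalSpace X]
    [LocallyCompactSpace X] [TopologicalSpace Y] [MeasurableSpace Y] [OpensMeasurableSpace Y]
    {μ : Measure Y} [IsFiniteMeasureOnCompacts μ] {f : X → Y → ℝ} (hf : Continuous f.uncurry)
    (hfs : ∀ K : Set X, IsCompact K → ∃ k : Set Y, IsCompact k ∧ ∀ x ∈ K, ∀ y ∉ k, f x y = 0) :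
    Continuous fun x => ∫ y, f x y ∂μ := by
  rw [continuous_iff_continuousAt]
  intro x
  obtain ⟨K, hK, hx⟩ := exists_compact_mem_nhds x
  obtain ⟨k, hk, h0⟩ := hfs K hK
  exact (continuousOn_integral_of_compact_support hk hf.continuousOn
    fun p y hp hy => h0 p hp y hy).continuousAt hx

/-! ### Fibre integrals over cosets of a closed subgroup -/

section Fiber

variable {G : Type*} [Group G] [TopologicalSpace G] [IsTopologicalGroup G]
  [MeasurableSpace G] [BorelSpace G]

/-- The integral over the fibres of `G → G/L` with respect to a left invariant measure on `L`. -/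
noncomputable def fiberIntegral (L : Subgroup G) (κ : Measure L) [κ.IsMulLeftInvariant]
    (φ : G → ℝ) : G ⧸ L → ℝ :=
  onQuotient L (fun x => ∫ l : L, φ (x * l) ∂κ) fun x k hk => by
    simpa [mul_assoc] using integral_mul_left_eq_self (μ := κ) (fun l : L => φ (x * l)) ⟨k, hk⟩

variable {L : Subgroup G} (κ : Measure L) [κ.IsMulLeftInvariant]

@[simp] theorem fiberIntegral_mk (φ : G → ℝ) (x : G) :
    fiberIntegral L κ φ (x : G ⧸ L) = ∫ l : L, φ (x * l) ∂κ := rfl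

theorem fiberIntegral_smul_left (φ : G → ℝ) (g : G) (q : G ⧸ L) :
    fiberIntegral L κ (fun x => φ (g * x)) q = fiberIntegral L κ φ (g • q) := by
  induction q using QuotientGroup.induction_on with
  | H x =>
    have : g • (x : G ⧸ L) = ((g * x : G) : G ⧸ L) := rfl
    simp [this, mul_assoc]

/-- A function pulled back from `G/L` is constant on each coset, so it leaves the fibre integral. No
regularity of `a` is needed. -/
theorem fiberIntegral_mul_right (φ : G → ℝ) (a : G ⧸ L → ℝ) (q : G ⧸ L) :
    fiberIntegral L κ (fun x => a x * φ x) q = a q * fiberIntegral L κ φ q := by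
  induction q using QuotientGroup.induction_on with
  | H x =>
    simp [← integral_const_mul, QuotientGroup.mk_mul_of_mem]

theorem fiberIntegral_nonneg {φ : G → ℝ} (hφ : ∀ x, 0 ≤ φ x) (q : G ⧸ L) :
    0 ≤ fiberIntegral L κ φ q := by
  induction q using QuotientGroup.induction_on with
  | H x => exact integral_nonneg fun l => hφ _

/-- The restriction of a compactly supported continuous function to a coset of a closed
subgroup. -/
def restrictCoset (hL : IsClosed (L : Set G)) (φ : C_c(G, ℝ)) (x : G) : C_c(L, ℝ) where
  toFun l := φ (x * l)
  hasCompactSupport' :=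
    φ.hasCompactSupport.comp_isClosedEmbedding
      ((Homeomorph.mulLeft x).isClosedEmbedding.comp hL.isClosedEmbedding_subtypeVal)

@[simp] theorem restrictCoset_apply (hL : IsClosed (L : Set G)) (φ : C_c(G, ℝ)) (x : G) (l : L) :
    restrictCoset hL φ x l = φ (x * l) := rfl

theorem integrable_coset [IsFiniteMeasureOnCompacts κ] (hL : IsClosed (L : Set G))
    (φ : C_c(G, ℝ)) (x : G) : Integrable (fun l : L => φ (x * l)) κ :=
  (restrictCoset hL φ x).continuous.integrable_of_hasCompactSupport
    (restrictCoset hL φ x).hasCompactSupport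

theorem fiberIntegral_add [IsFiniteMeasureOnCompacts κ] (hL : IsClosed (L : Set G))
    (φ ψ : C_c(G, ℝ)) (q : G ⧸ L) :
    fiberIntegral L κ (φ + ψ) q = fiberIntegral L κ φ q + fiberIntegral L κ ψ q := by
  induction q using QuotientGroup.induction_on with
  | H x =>
    simpa using integral_add (integrable_coset κ hL φ x) (integrable_coset κ hL ψ x)

theorem fiberIntegral_smul (c : ℝ) (φ : G → ℝ) (q : G ⧸ L) :
    fiberIntegral L κ (c • φ) q = c * fiberIntegral L κ φ q := by
  induction q using QuotientGroup.induction_on with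
  | H x => simp [integral_const_mul]

variable [T2Space G] [LocallyCompactSpace G]

theorem continuous_integral_coset [IsFiniteMeasureOnCompacts κ] (hL : IsClosed (L : Set G))
    (φ : C_c(G, ℝ)) : Continuous fun x : G => ∫ l : L, φ (x * l) ∂κ := by
  refine continuous_integral_of_locally_compact_support (f := fun x (l : L) => φ (x * l))
    (by fun_prop) fun K hK => ?_
  refine ⟨Subtype.val ⁻¹' (K⁻¹ * tsupport φ), hL.isClosedEmbedding_subtypeVal.isCompact_preimage
    (hK.inv.mul φ.hasCompactSupport), fun x hx l hl => ?_⟩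
  by_contra h
  exact hl ⟨x⁻¹, by simpa using hx, x * l, subset_tsupport _ h, by simp⟩

/-- The fibre integral as a map between spaces of compactly supported continuous functions. -/
noncomputable def fiberIntegralCc [IsFiniteMeasureOnCompacts κ] (hL : IsClosed (L : Set G))
    (φ : C_c(G, ℝ)) : C_c(G ⧸ L, ℝ) where
  toFun := fiberIntegral L κ φ
  continuous_toFun := (continuous_integral_coset κ hL φ).quotient_lift _
  hasCompactSupport' := by
    haveI := hL
    refine HasCompactSupport.intro (φ.hasCompactSupport.image
      (QuotientGroup.continuous_mk (N := L))) fun q hq => ?_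
    induction q using QuotientGroup.induction_on with
    | H x =>
      rw [fiberIntegral_mk]
      refine integral_eq_zero_of_ae (Eventually.of_forall fun l => ?_)
      by_contra h
      exact hq ⟨x * l, subset_tsupport _ h, by simp [QuotientGroup.mk_mul_of_mem]⟩

/-- A continuous cutoff function whose fibre integrals are `1` over a given compact set. -/
theorem exists_fiberIntegral_eq_one {L : Subgroup G} (κ : Measure L) [κ.IsHaarMeasure]
    (hL : IsClosed (L : Set G)) {K : Set G}
    (hK : IsCompact K) :
    ∃ ψ : C_c(G, ℝ), (∀ x, 0 ≤ ψ x) ∧ ∀ x ∈ K, fiberIntegral L κ ψ (x : G ⧸ L) = 1 := by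
  obtain ⟨ψ₀, h1, -, hc, h01⟩ := exists_continuous_one_zero_of_isCompact hK isClosed_empty
    (disjoint_empty K)
  let ψ₁ : C_c(G, ℝ) := ⟨ψ₀, hc⟩
  set T : G → ℝ := fun x => fiberIntegral L κ ψ₁ (x : G ⧸ L) with hT
  have hTc : Continuous T := continuous_integral_coset κ hL ψ₁
  have hTpos : ∀ x ∈ K, 0 < T x := fun x hx => by
    refine (restrictCoset hL ψ₁ x).continuous.integral_pos_of_hasCompactSupport_nonneg_nonzero
      (restrictCoset hL ψ₁ x).hasCompactSupport (fun l => (h01 _).1) (x := 1) ?_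
    have : ψ₀ x = 1 := h1 hx
    simp [ψ₁, this]
  obtain ⟨δ, hδ, hTδ⟩ : ∃ δ > 0, ∀ x ∈ K, δ ≤ T x := by
    rcases K.eq_empty_or_nonempty with rfl | hne
    · exact ⟨1, one_pos, by simp⟩
    · obtain ⟨x₀, hx₀, hmin⟩ := hK.exists_isMinOn hne hTc.continuousOn
      exact ⟨T x₀, hTpos x₀ hx₀, fun x hx => hmin hx⟩
  -- Truncating at the positive lower bound δ of the fibre integral over `K` keeps the reciprocal
  -- continuous everywhere and changes nothing over `K`.
  let a : G ⧸ L → ℝ := fun q => (max (fiberIntegral L κ ψ₁ q) δ)⁻¹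
  have hac : Continuous fun x : G => a x :=
    (hTc.max continuous_const).inv₀ fun x => (lt_max_of_lt_right hδ).ne'
  refine ⟨⟨⟨fun x => a x * ψ₁ x, hac.mul ψ₁.continuous⟩, hc.mul_left⟩, fun x => ?_, fun x hx => ?_⟩
  · exact mul_nonneg (inv_nonneg.2 (le_max_of_le_right hδ.le)) (h01 x).1
  · have := fiberIntegral_mul_right κ ψ₁ a (x : G ⧸ L)
    refine this.trans ?_
    have h2 : max (fiberIntegral L κ ψ₁ (x : G ⧸ L)) δ = T x := max_eq_left (hTδ x hx)
    simp only [a, h2]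
    exact inv_mul_cancel₀ (hTpos x hx).ne'

/-- Compact subsets of `G/L` are images of compact subsets of `G`. -/
theorem exists_isCompact_image_mk_superset {C : Set (G ⧸ L)} (hC : IsCompact C) :
    ∃ K : Set G, IsCompact K ∧ C ⊆ QuotientGroup.mk '' K := by
  choose k hk hxk using fun x : G => exists_compact_mem_nhds x
  obtain ⟨t, -, ht⟩ := hC.elim_nhds_subcover (fun q => (QuotientGroup.mk '' k q.out : Set (G ⧸ L)))
    fun q _ => by
      have := (QuotientGroup.isOpenMap_coe (N := L)).image_mem_nhds (hxk q.out)
      rwa [QuotientGroup.out_eq'] at this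
  refine ⟨⋃ q ∈ t, k q.out, t.finite_toSet.isCompact_biUnion fun q _ => hk _, ?_⟩
  simpa [image_iUnion] using ht

end Fiber

/-! ### Uniqueness of Haar measure and Weil's formula on C_c(G) -/

section Uniqueness

variable {G : Type*} [Group G] [TopologicalSpace G] [IsTopologicalGroup G]
  [T2Space G] [LocallyCompactSpace G] [MeasurableSpace G] [BorelSpace G]

/-- Left translation of compactly supported continuous functions. -/
def translateLeft (g : G) (φ : C_c(G, ℝ)) : C_c(G, ℝ) where
  toFun x := φ (g * x)
  hasCompactSupport' := φ.hasCompactSupport.comp_homeomorph (Homeomorph.mulLeft g)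

@[simp] theorem translateLeft_apply (g : G) (φ : C_c(G, ℝ)) (x : G) :
    translateLeft g φ x = φ (g * x) := rfl

/-- A positive linear functional on `C_c(G)` that is invariant under left translations is a
multiple of the Haar integral. -/
theorem exists_eq_mul_integral_of_translateLeft (μ : Measure G) [μ.IsHaarMeasure]
    (Λ : C_c(G, ℝ) → ℝ) (hadd : ∀ φ ψ, Λ (φ + ψ) = Λ φ + Λ ψ)
    (hsmul : ∀ (c : ℝ) φ, Λ (c • φ) = c * Λ φ) (hnonneg : ∀ φ, (∀ x, 0 ≤ φ x) → 0 ≤ Λ φ)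
    (hΛ : ∀ g φ, Λ (translateLeft g φ) = Λ φ) :
    ∃ c : ℝ≥0, ∀ φ, Λ φ = c * ∫ x, φ x ∂μ := by
  let Λ' : C_c(G, ℝ) →ₚ[ℝ] ℝ := PositiveLinearMap.mk₀
    { toFun := Λ, map_add' := hadd, map_smul' := hsmul } fun φ hφ => hnonneg φ hφ
  let σ := RealRMK.rieszMeasure Λ'
  have hσ : ∀ φ : C_c(G, ℝ), ∫ x, φ x ∂σ = Λ φ := RealRMK.integral_rieszMeasure Λ'
  -- A regular measure is determined by its integrals on C_c(G), so invariance passes from the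
  -- functional to its Riesz measure.
  haveI : σ.IsMulLeftInvariant := ⟨fun g => by
    haveI : (Measure.map (g * ·) σ).Regular := Measure.Regular.map (Homeomorph.mulLeft g)
    refine Measure.ext_of_integral_eq_on_compactlySupported fun φ => ?_
    rw [integral_map (by fun_prop) (map_continuous φ).aestronglyMeasurable, hσ, ← hΛ g, ← hσ]
    rfl⟩
  refine ⟨Measure.haarScalarFactor σ μ, fun φ => ?_⟩
  rw [← hσ, Measure.integral_isMulLeftInvariant_eq_smul_of_hasCompactSupport σ μ (map_continuous φ)
    φ.hasCompactSupport, integral_smul_nnreal_measure]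
  rfl

/-- **Weil's formula**: integrating fibre integrals over `G/L` against an invariant measure is,
up to a constant, Haar integration over `G`. -/
theorem exists_integral_fiberIntegral_eq {L : Subgroup G} (hL : IsClosed (L : Set G))
    (κ : Measure L) [κ.IsMulLeftInvariant] [IsFiniteMeasureOnCompacts κ]
    [MeasurableSpace (G ⧸ L)] [BorelSpace (G ⧸ L)] (ν : Measure (G ⧸ L))
    [IsFiniteMeasureOnCompacts ν] [SMulInvariantMeasure G (G ⧸ L) ν]
    (μ : Measure G) [μ.IsHaarMeasure] :
    ∃ c : ℝ≥0, ∀ φ : C_c(G, ℝ), ∫ q, fiberIntegral L κ φ q ∂ν = c * ∫ x, φ x ∂μ := by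
  have hint : ∀ φ : C_c(G, ℝ), Integrable (fiberIntegral L κ φ) ν := fun φ =>
    (fiberIntegralCc κ hL φ).continuous.integrable_of_hasCompactSupport
      (fiberIntegralCc κ hL φ).hasCompactSupport
  refine exists_eq_mul_integral_of_translateLeft μ (fun φ => ∫ q, fiberIntegral L κ φ q ∂ν)
    (fun φ ψ => ?_) (fun c φ => ?_) (fun φ hφ => integral_nonneg (fiberIntegral_nonneg κ hφ))
    fun g φ => ?_
  · rw [← integral_add (hint φ) (hint ψ)]
    exact integral_congr_ae (Eventually.of_forall (fiberIntegral_add κ hL φ ψ))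
  · rw [← integral_const_mul]
    exact integral_congr_ae (Eventually.of_forall (fiberIntegral_smul κ c φ))
  · rw [← integral_smul_eq_self (μ := ν) (fiberIntegral L κ φ) (g := g)]
    exact integral_congr_ae (Eventually.of_forall (fiberIntegral_smul_left κ φ g))

end Uniqueness

/-! ### Termwise integration and expansion of L¹ functions in series from C_c -/

section Series

variable {α : Type*} [MeasurableSpace α] {μ : Measure α}

theorem tsum_lintegral_enorm_ne_top_of_summable {F : ℕ → α → ℝ} (hF : ∀ i, Integrable (F i) μ)
    (hs : Summable fun i => ∫ a, ‖F i a‖ ∂μ) : ∑' i, ∫⁻ a, ‖F i a‖ₑ ∂μ ≠ ∞ := by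
  have h : ∀ i, ∫⁻ a, ‖F i a‖ₑ ∂μ = ENNReal.ofReal (∫ a, ‖F i a‖ ∂μ) := fun i =>
    (ofReal_integral_norm_eq_lintegral_enorm (hF i)).symm
  simp_rw [h]
  exact hs.tsum_ofReal_ne_top

theorem ae_summable_of_summable_integral_norm {F : ℕ → α → ℝ} (hF : ∀ i, Integrable (F i) μ)
    (hs : Summable fun i => ∫ a, ‖F i a‖ ∂μ) : ∀ᵐ a ∂μ, Summable fun i => ‖F i a‖ := by
  have h := tsum_lintegral_enorm_ne_top_of_summable hF hs
  rw [← lintegral_tsum fun i => (hF i).1.enorm] at h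
  filter_upwards [ae_lt_top' (AEMeasurable.tsum fun i => (hF i).1.enorm) h] with a ha
  have := ENNReal.summable_toReal ha.ne
  simpa using this

/-- Measurability of `f` is not assumed: it is inherited from the partial sums as an a.e. limit. -/
theorem integrable_of_hasSum_of_summable_integral_norm {F : ℕ → α → ℝ} {f : α → ℝ}
    (hF : ∀ i, Integrable (F i) μ) (hs : Summable fun i => ∫ a, ‖F i a‖ ∂μ)
    (hf : ∀ᵐ a ∂μ, HasSum (fun i => F i a) (f a)) :
    Integrable f μ ∧ HasSum (fun i => ∫ a, F i a ∂μ) (∫ a, f a ∂μ) := by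
  have h := tsum_lintegral_enorm_ne_top_of_summable hF hs
  rw [← lintegral_tsum fun i => (hF i).1.enorm] at h
  refine ⟨⟨?_, ?_⟩, ?_⟩
  · refine aestronglyMeasurable_of_tendsto_ae (u := atTop)
      (f := fun n a => ∑ i ∈ Finset.range n, F i a) (fun n => ?_) ?_
    · exact (integrable_finsetSum _ fun i _ => hF i).1
    · filter_upwards [hf] with a ha using ha.tendsto_sum_nat
  · refine lt_of_le_of_lt (lintegral_mono_ae ?_) (lt_top_iff_ne_top.2 h)
    filter_upwards [hf] with a ha
    rw [← ha.tsum_eq]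
    exact enorm_tsum_le_tsum_enorm
  · have := hasSum_integral_of_summable_integral_norm hF hs
    rwa [integral_congr_ae (hf.mono fun a ha => ha.tsum_eq)] at this

variable [TopologicalSpace α] [R1Space α] [LocallyCompactSpace α] [BorelSpace α] [μ.Regular]

/-- Density of the compactly supported continuous functions in `L¹`. Contrary to
`Integrable.exists_hasCompactSupport_integral_sub_le`, normality is not assumed. -/
theorem exists_compactlySupported_integral_sub_le {u : α → ℝ} (hu : Integrable u μ) {ε : ℝ}
    (hε : 0 < ε) : ∃ g : C_c(α, ℝ), ∫ a, ‖u a - g a‖ ∂μ ≤ ε := by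
  obtain ⟨g, hgε, g', rfl⟩ : ∃ g : α → ℝ, eLpNorm (u - g) 1 μ ≤ ENNReal.ofReal ε ∧
      ∃ g' : C_c(α, ℝ), ⇑g' = g := by
    refine (memLp_one_iff_integrable.2 hu).induction_dense ENNReal.one_ne_top _ ?_ ?_ ?_
      (by simpa using hε)
    · intro c t ht htμ δ hδ
      obtain ⟨η, hη, hηδ⟩ := exists_eLpNorm_indicator_le (μ := μ) ENNReal.one_ne_top c hδ
      have hη2 : ((η / 2 : ℝ≥0) : ℝ≥0∞) ≠ 0 := by simpa using hη.ne'
      obtain ⟨K, hKt, hK, hKc, hKμ⟩ := ht.exists_isCompact_isClosed_sdiff_lt htμ.ne hη2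
      obtain ⟨U, htU, hU, -, hUμ⟩ := ht.exists_isOpen_sdiff_lt htμ.ne hη2
      obtain ⟨φ, h1, h0, hφc, h01⟩ := exists_continuous_one_zero_of_isCompact hK hU.isClosed_compl
        (disjoint_compl_right_iff_subset.2 (hKt.trans htU))
      refine ⟨_, ?_, c • ⟨φ, hφc⟩, rfl⟩
      -- With K ⊆ t ⊆ U, the error c·φ − c·1_t vanishes off `U \ K` and is at most |c| there; `U \
      -- t` and `t \ K` each contribute measure at most η/2.
      refine (eLpNorm_mono (g := (U \ K).indicator fun _ => c) fun x => ?_).trans (hηδ _ ?_)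
      · by_cases hxK : x ∈ K
        · have : φ x = 1 := h1 hxK
          simp [hxK, hKt hxK, this]
        by_cases hxU : x ∈ U
        · have h01 := h01 x
          rw [indicator_of_mem (show x ∈ U \ K from ⟨hxU, hxK⟩)]
          by_cases hxt : x ∈ t
          · have : c * φ x - c = c * (φ x - 1) := by ring
            simp only [CompactlySupportedContinuousMap.coe_smul, Pi.sub_apply, Pi.smul_apply,
              CompactlySupportedContinuousMap.coe_mk, smul_eq_mul, hxt, indicator_of_mem, this,
              norm_mul]
            refine mul_le_of_le_one_right (norm_nonneg _) ?_
            rw [Real.norm_eq_abs, abs_le]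
            constructor <;> linarith [h01.1, h01.2]
          · simp only [CompactlySupportedContinuousMap.coe_smul, Pi.sub_apply, Pi.smul_apply,
              CompactlySupportedContinuousMap.coe_mk, smul_eq_mul, hxt, not_false_eq_true,
              indicator_of_notMem, sub_zero, norm_mul]
            refine mul_le_of_le_one_right (norm_nonneg _) ?_
            rw [Real.norm_eq_abs, abs_le]
            constructor <;> linarith [h01.1, h01.2]
        · have : φ x = 0 := h0 hxU
          have hxt : x ∉ t := fun h => hxU (htU h)
          simp [hxU, hxt, this]
      · have hsub : U \ K ⊆ (U \ t) ∪ (t \ K) := fun x hx => by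
          by_cases hxt : x ∈ t
          · exact Or.inr ⟨hxt, hx.2⟩
          · exact Or.inl ⟨hx.1, hxt⟩
        refine (measure_mono hsub).trans ((measure_union_le _ _).trans ?_)
        refine (add_le_add hUμ.le hKμ.le).trans ?_
        rw [← ENNReal.coe_add, add_halves]
    · rintro _ _ ⟨f, rfl⟩ ⟨g, rfl⟩
      exact ⟨f + g, rfl⟩
    · rintro _ ⟨f, rfl⟩
      exact ((map_continuous f).integrable_of_hasCompactSupport f.hasCompactSupport).1
  refine ⟨g', ?_⟩
  have hg : Integrable g' μ :=
    (map_continuous g').integrable_of_hasCompactSupport g'.hasCompactSupport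
  rw [eLpNorm_one_eq_lintegral_enorm] at hgε
  have := ofReal_integral_norm_eq_lintegral_enorm (hu.sub hg)
  rw [← this] at hgε
  exact (ENNReal.ofReal_le_ofReal_iff hε.le).1 hgε

/-- An integrable function is almost everywhere the sum of a series of compactly supported
continuous functions that converges in `L¹`. -/
theorem exists_compactlySupported_hasSum {u : α → ℝ} (hu : Integrable u μ) :
    ∃ d : ℕ → C_c(α, ℝ), (Summable fun i => ∫ a, ‖d i a‖ ∂μ) ∧
      ∀ᵐ a ∂μ, HasSum (fun i => d i a) (u a) := by
  have hint : ∀ g : C_c(α, ℝ), Integrable g μ := fun g =>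
    (map_continuous g).integrable_of_hasCompactSupport g.hasCompactSupport
  have hex : ∀ n : ℕ, ∃ g : C_c(α, ℝ), ∫ a, ‖u a - g a‖ ∂μ ≤ (1 / 2 : ℝ) ^ n := fun n =>
    exists_compactlySupported_integral_sub_le hu (by positivity)
  choose g₀ hg₀ using hex
  -- Starting the approximations at 0 makes the telescoping series sum to `u` itself, not to `u - g
  -- 0`.
  obtain ⟨g, hg0, hg⟩ : ∃ g : ℕ → C_c(α, ℝ), g 0 = 0 ∧
      Summable fun n => ∫ a, ‖u a - g n a‖ ∂μ := by
    refine ⟨fun n => Nat.casesOn n 0 g₀, rfl, ?_⟩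
    rw [← summable_nat_add_iff 1]
    exact Summable.of_nonneg_of_le (fun n => integral_nonneg fun a => norm_nonneg _) hg₀
      summable_geometric_two
  have hug : ∀ n, Integrable (fun a => u a - g n a) μ := fun n => hu.sub (hint _)
  obtain ⟨d, hd⟩ : ∃ d : ℕ → C_c(α, ℝ), ∀ n a, d n a = g (n + 1) a - g n a :=
    ⟨fun n => g (n + 1) - g n, fun n a => rfl⟩
  have hle : ∀ n a, ‖d n a‖ ≤ ‖u a - g (n + 1) a‖ + ‖u a - g n a‖ := fun n a => by
    have : d n a = (u a - g n a) - (u a - g (n + 1) a) := by rw [hd]; ring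
    rw [this]
    exact (norm_sub_le _ _).trans_eq (add_comm _ _)
  refine ⟨d, ?_, ?_⟩
  · refine Summable.of_nonneg_of_le (fun n => integral_nonneg fun a => norm_nonneg _) (fun n => ?_)
      (((summable_nat_add_iff 1).2 hg).add hg)
    rw [← integral_add (hug (n + 1)).norm (hug n).norm]
    exact integral_mono (hint _).norm ((hug (n + 1)).norm.add (hug n).norm) (hle n)
  · filter_upwards [ae_summable_of_summable_integral_norm hug hg] with a ha
    have hs : Summable fun n => d n a :=
      Summable.of_norm_bounded (((summable_nat_add_iff 1).2 ha).add ha) fun n => hle n a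
    rw [hs.hasSum_iff_tendsto_nat]
    have ht : Tendsto (fun n => g n a) atTop (𝓝 (u a)) := by
      have := ha.of_norm.tendsto_atTop_zero.const_sub (u a)
      simpa using this
    refine ht.congr fun n => ?_
    simp_rw [hd]
    rw [Finset.sum_range_sub (fun n => g n a) n, hg0]
    simp

end Series

/-! ### Weil's formula for integrable, not necessarily continuous, functions -/

section Descent

variable {G : Type*} [Group G] [TopologicalSpace G] [IsTopologicalGroup G]
  [T2Space G] [LocallyCompactSpace G] [MeasurableSpace G] [BorelSpace G]
  {L : Subgroup G} (hL : IsClosed (L : Set G))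
  (κ : Measure L) [κ.IsMulLeftInvariant]
  [MeasurableSpace (G ⧸ L)] [BorelSpace (G ⧸ L)] {ν : Measure (G ⧸ L)}
  {μ : Measure G} {c : ℝ≥0}

include hL in
theorem integrable_fiberIntegral [IsFiniteMeasureOnCompacts κ] [IsFiniteMeasureOnCompacts ν]
    (φ : C_c(G, ℝ)) : Integrable (fiberIntegral L κ φ) ν :=
  (fiberIntegralCc κ hL φ).continuous.integrable_of_hasCompactSupport
    (fiberIntegralCc κ hL φ).hasCompactSupport

variable [κ.Regular] [ν.Regular] [μ.Regular]
  (hc : ∀ φ : C_c(G, ℝ), ∫ q, fiberIntegral L κ φ q ∂ν = c * ∫ x, φ x ∂μ)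

include hL hc

/-- Markov's inequality for the fibre integral, combined with Weil's formula and φ ≤ 1_U. -/
theorem mul_measure_lt_fiberIntegral_le {U : Set G} (hU : IsOpen U) (φ : C_c(G, ℝ))
    (h0 : ∀ x, 0 ≤ φ x) (h1 : ∀ x, φ x ≤ 1) (hφU : ∀ x ∉ U, φ x = 0) (t : ℝ) :
    ENNReal.ofReal t * ν {q | t < fiberIntegral L κ φ q} ≤ c * μ U := by
  calc ENNReal.ofReal t * ν {q | t < fiberIntegral L κ φ q}
      ≤ ENNReal.ofReal t * ν {q | ENNReal.ofReal t ≤ ENNReal.ofReal (fiberIntegral L κ φ q)} := by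
        gcongr with q
        exact fun h => ENNReal.ofReal_le_ofReal (le_of_lt h)
    _ ≤ ∫⁻ q, ENNReal.ofReal (fiberIntegral L κ φ q) ∂ν :=
        mul_meas_ge_le_lintegral₀ (integrable_fiberIntegral hL κ φ).1.aemeasurable.ennreal_ofReal _
    _ = ENNReal.ofReal (c * ∫ x, φ x ∂μ) := by
        rw [← hc, ofReal_integral_eq_lintegral_ofReal (integrable_fiberIntegral hL κ φ)
          (Eventually.of_forall (fiberIntegral_nonneg κ h0))]
    _ = c * ∫⁻ x, ENNReal.ofReal (φ x) ∂μ := by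
        rw [ENNReal.ofReal_mul c.coe_nonneg, ENNReal.ofReal_coe_nnreal, ofReal_integral_eq_lintegral_ofReal
          ((map_continuous φ).integrable_of_hasCompactSupport φ.hasCompactSupport)
          (Eventually.of_forall h0)]
    _ ≤ c * ∫⁻ x, U.indicator 1 x ∂μ := by
        gcongr with x
        by_cases hx : x ∈ U
        · simpa [hx] using h1 x
        · simp [hx, hφU x hx]
    _ = c * μ U := by rw [lintegral_indicator_one hU.measurableSet]

/-- Inner regularity of κ covers the set by the open sets {fibre integral of φ > t}, with φ in
C_c(G) between 0 and 1_U. This family is directed under suprema, so a compact subset of its possibly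
uncountable union lies in one member. Inner regularity of ν on open sets then carries over the bound
for a single φ. -/
theorem measure_lt_measure_fiber_le {U : Set G} (hU : IsOpen U) {t : ℝ} (ht : 0 < t) :
    ENNReal.ofReal t * ν {q | ∃ x : G, (x : G ⧸ L) = q ∧
      ENNReal.ofReal t < κ {l : L | x * l ∈ U}} ≤ c * μ U := by
  let S := {φ : C_c(G, ℝ) // (∀ x, 0 ≤ φ x) ∧ (∀ x, φ x ≤ 1) ∧ ∀ x ∉ U, φ x = 0}
  let V : S → Set (G ⧸ L) := fun φ => {q | t < fiberIntegral L κ φ.1 q}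
  have hV : ∀ φ, IsOpen (V φ) := fun φ =>
    isOpen_lt continuous_const (fiberIntegralCc κ hL φ.1).continuous
  have hdir : Directed (· ⊆ ·) V := by
    intro φ ψ
    refine ⟨⟨φ.1 ⊔ ψ.1, fun x => ?_, fun x => ?_, fun x hx => ?_⟩, ?_, ?_⟩
    · exact le_sup_of_le_left (φ.2.1 x)
    · exact sup_le (φ.2.2.1 x) (ψ.2.2.1 x)
    · simp [φ.2.2.2 x hx, ψ.2.2.2 x hx]
    all_goals
      intro q hq
      induction q using QuotientGroup.induction_on with
      | H x =>
        refine lt_of_lt_of_le (show t < _ from hq) ?_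
        refine integral_mono (integrable_coset κ hL _ x) (integrable_coset κ hL _ x) fun l => ?_
        simp
  haveI : Nonempty S := ⟨⟨0, by simp⟩⟩
  have hsub : {q | ∃ x : G, (x : G ⧸ L) = q ∧ ENNReal.ofReal t < κ {l : L | x * l ∈ U}} ⊆
      ⋃ φ, V φ := by
    rintro _ ⟨x, rfl, hx⟩
    have hUx : IsOpen {l : L | x * l ∈ U} := hU.preimage (by fun_prop)
    obtain ⟨K, hKU, hK, hKt⟩ := hUx.exists_lt_isCompact hx
    have hK' : IsCompact ((fun l : L => x * (l : G)) '' K) := hK.image (by fun_prop)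
    obtain ⟨φ, h1, h0, hφc, h01⟩ := exists_continuous_one_zero_of_isCompact hK' hU.isClosed_compl
      (disjoint_compl_right_iff_subset.2 (image_subset_iff.2 hKU))
    refine mem_iUnion.2 ⟨⟨⟨φ, hφc⟩, fun y => (h01 y).1, fun y => (h01 y).2, fun y hy => h0 hy⟩, ?_⟩
    have hle : ∫ l, K.indicator 1 l ∂κ ≤ ∫ l : L, φ (x * l) ∂κ := by
      refine integral_mono ((integrable_indicator_iff hK.measurableSet).2
        (integrableOn_const hK.measure_ne_top)) (integrable_coset κ hL ⟨φ, hφc⟩ x) fun l => ?_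
      by_cases hl : l ∈ K
      · have : φ (x * l) = 1 := h1 (mem_image_of_mem _ hl)
        simp [hl, this]
      · simpa [hl] using (h01 _).1
    rw [integral_indicator_one hK.measurableSet] at hle
    refine lt_of_lt_of_le ?_ hle
    exact (ENNReal.ofReal_lt_iff_lt_toReal ht.le hK.measure_ne_top).1 hKt
  refine (mul_le_mul_right (measure_mono hsub) _).trans ?_
  rw [(isOpen_iUnion hV).measure_eq_iSup_isCompact]
  simp_rw [ENNReal.mul_iSup]
  refine iSup₂_le fun C hCV => iSup_le fun hC => ?_
  obtain ⟨φ, hφ⟩ := hC.elim_directed_cover V hV hCV hdir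
  exact (mul_le_mul_right (measure_mono hφ) _).trans
    (mul_measure_lt_fiberIntegral_le hL κ hc hU φ.1 φ.2.1 φ.2.2.1 φ.2.2.2 t)

/-- Almost every fibre of a null set is null. -/
theorem ae_measure_fiber_eq_zero {N : Set G} (hN : μ N = 0) :
    ∀ᵐ q ∂ν, ∀ x : G, (x : G ⧸ L) = q → κ {l : L | x * l ∈ N} = 0 := by
  have key : ∀ n : ℕ, ν {q | ∃ x : G, (x : G ⧸ L) = q ∧
      ENNReal.ofReal (1 / ((n : ℝ) + 1)) < κ {l : L | x * l ∈ N}} = 0 := by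
    intro n
    set t : ℝ := 1 / ((n : ℝ) + 1)
    have ht : 0 < t := Nat.one_div_pos_of_nat
    have hmul : ENNReal.ofReal t * ν {q | ∃ x : G, (x : G ⧸ L) = q ∧
        ENNReal.ofReal t < κ {l : L | x * l ∈ N}} ≤ 0 := by
      refine ENNReal.le_of_forall_pos_le_add fun ε hε _ => ?_
      -- The denominator c + 1 makes c·μ(U) ≤ ε and allows c = 0.
      obtain ⟨U, hNU, hU, hμU⟩ := N.exists_isOpen_le_add μ
        (ε := (ε / (c + 1) : ℝ≥0)) (by positivity)
      rw [hN, zero_add] at hμU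
      calc _ ≤ ENNReal.ofReal t * ν {q | ∃ x : G, (x : G ⧸ L) = q ∧
            ENNReal.ofReal t < κ {l : L | x * l ∈ U}} := by
            gcongr with q
        _ ≤ c * μ U := measure_lt_measure_fiber_le hL κ hc hU ht
        _ ≤ (c * (ε / (c + 1)) : ℝ≥0) := by
            rw [ENNReal.coe_mul]
            exact mul_le_mul_right hμU _
        _ ≤ 0 + ε := by
            rw [zero_add, ENNReal.coe_le_coe, mul_div_left_comm]
            exact mul_le_of_le_one_right' (div_le_one_of_le₀ (by simp) (by positivity))
    simpa [ht.not_ge] using hmul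
  have := ae_all_iff.2 fun n => measure_eq_zero_iff_ae_notMem.1 (key n)
  filter_upwards [this] with q hq x hx
  by_contra h
  obtain ⟨r, hr0, hr⟩ := ENNReal.lt_iff_exists_nnreal_btwn.1 (pos_iff_ne_zero.2 h)
  obtain ⟨n, hn⟩ := exists_nat_one_div_lt (show (0 : ℝ) < r by simpa using hr0)
  refine hq n ⟨x, hx, lt_of_le_of_lt ?_ hr⟩
  rw [← ENNReal.ofReal_coe_nnreal]
  exact ENNReal.ofReal_le_ofReal hn.le

/-- Integration over `G/L` of a function on `G/L` that is only known to be locally integrable as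
a function on `G`. -/
theorem integrable_mul_fiberIntegral (r : G ⧸ L → ℝ) (ψ : C_c(G, ℝ))
    (hψ : Integrable (fun x : G => ψ x * r x) μ) (f : C_c(G ⧸ L, ℝ)) :
    Integrable (fun q => f q * (r q * fiberIntegral L κ ψ q)) ν ∧
      ∫ q, f q * (r q * fiberIntegral L κ ψ q) ∂ν = c * ∫ x : G, f x * (ψ x * r x) ∂μ := by
  obtain ⟨d, hds, hd⟩ := exists_compactlySupported_hasSum hψ
  have hdint : ∀ i, Integrable (d i) μ := fun i =>
    (map_continuous (d i)).integrable_of_hasCompactSupport (d i).hasCompactSupport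
  obtain ⟨M, hM⟩ : ∃ M, ∀ q, ‖f q‖ ≤ M :=
    f.hasCompactSupport.exists_bound_of_continuous (map_continuous f)
  let a : ℕ → C_c(G, ℝ) := fun i => ⟨⟨fun x => ‖d i x‖, (map_continuous (d i)).norm⟩,
    (d i).hasCompactSupport.norm⟩
  let p : ℕ → C_c(G, ℝ) := fun i => ⟨⟨fun x => f x * d i x,
    ((map_continuous f).comp QuotientGroup.continuous_mk).mul (map_continuous (d i))⟩,
    (d i).hasCompactSupport.mul_left⟩
  have hTp : ∀ i q, fiberIntegral L κ (p i) q = f q * fiberIntegral L κ (d i) q := fun i =>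
    fiberIntegral_mul_right κ (d i) f
  have hnorm : ∀ i q, ‖fiberIntegral L κ (d i) q‖ ≤ fiberIntegral L κ (a i) q := by
    intro i q
    induction q using QuotientGroup.induction_on with
    | H x => exact norm_integral_le_integral_norm _
  have hae : ∀ᵐ q ∂ν, Summable fun i => fiberIntegral L κ (a i) q := by
    have h := ae_summable_of_summable_integral_norm (μ := ν)
      (F := fun i => fiberIntegral L κ (a i)) (fun i => integrable_fiberIntegral hL κ (a i)) ?_
    · filter_upwards [h] with q hq using hq.of_norm
    · refine (hds.mul_left (c : ℝ)).congr fun i => ?_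
      refine Eq.trans (hc (a i)).symm ?_
      refine integral_congr_ae (Eventually.of_forall fun q => ?_)
      exact (Real.norm_of_nonneg (fiberIntegral_nonneg κ (fun x => norm_nonneg (d i x)) q)).symm
  have hsumQ : ∀ᵐ q ∂ν, HasSum (fun i => fiberIntegral L κ (p i) q)
      (f q * (r q * fiberIntegral L κ ψ q)) := by
    filter_upwards [hae, ae_measure_fiber_eq_zero hL κ hc (ae_iff.1 hd)] with q hq1 hq2
    simp_rw [hTp]
    refine HasSum.mul_left _ ?_
    induction q using QuotientGroup.induction_on with
    | H x =>
      -- The exceptional null set of the expansion meets this fibre in a null set, and `r` is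
      -- constant along the fibre, so the series can be integrated over the fibre with `r` as a
      -- scalar.
      have hfib : ∀ᵐ l : L ∂κ, HasSum (fun i => d i (x * l)) (r (x : G ⧸ L) * ψ (x * l)) := by
        have h0 : ∀ᵐ l : L ∂κ, HasSum (fun i => d i (x * l))
          (ψ (x * l) * r ((x * l : G) : G ⧸ L)) := ae_iff.2 (hq2 x rfl)
        filter_upwards [h0] with l hl
        rwa [QuotientGroup.mk_mul_of_mem x l.2, mul_comm] at hl
      have := (integrable_of_hasSum_of_summable_integral_norm
        (fun i => integrable_coset κ hL (d i) x) hq1 hfib).2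
      rwa [integral_const_mul] at this
  have hsum : ∀ᵐ x ∂μ, HasSum (fun i => p i x) (f x * (ψ x * r x)) := by
    filter_upwards [hd] with x hx using hx.mul_left _
  have hpQ := fun i => integrable_fiberIntegral (ν := ν) hL κ (p i)
  have hp : ∀ i, Integrable (p i) μ := fun i =>
    (map_continuous (p i)).integrable_of_hasCompactSupport (p i).hasCompactSupport
  have hpn : ∀ i, ∫ x, ‖p i x‖ ∂μ ≤ M * ∫ x, ‖d i x‖ ∂μ := fun i => by
    rw [← integral_const_mul]
    refine integral_mono (hp i).norm ((hdint i).norm.const_mul _) fun x => ?_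
    simp only [p]
    refine (norm_mul _ _).trans_le ?_
    exact mul_le_mul_of_nonneg_right (hM _) (norm_nonneg _)
  have hpQn : ∀ i, ∫ q, ‖fiberIntegral L κ (p i) q‖ ∂ν ≤ c * (M * ∫ x, ‖d i x‖ ∂μ) := fun i => by
    have := hc (a i)
    rw [mul_left_comm, show ∫ x, ‖d i x‖ ∂μ = ∫ x, a i x ∂μ from rfl, ← this,
      ← integral_const_mul]
    refine integral_mono (hpQ i).norm ((integrable_fiberIntegral hL κ (a i)).const_mul _)
      fun q => ?_
    simp only [hTp, norm_mul]
    exact mul_le_mul (hM q) (hnorm i q) (norm_nonneg _) ((norm_nonneg _).trans (hM q))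
  obtain ⟨h1, h2⟩ := integrable_of_hasSum_of_summable_integral_norm hpQ
    (Summable.of_nonneg_of_le (fun i => integral_nonneg fun q => norm_nonneg _) hpQn
      ((hds.mul_left M).mul_left _)) hsumQ
  obtain ⟨-, h3⟩ := integrable_of_hasSum_of_summable_integral_norm hp
    (Summable.of_nonneg_of_le (fun i => integral_nonneg fun q => norm_nonneg _) hpn
      (hds.mul_left M)) hsum
  refine ⟨h1, h2.unique ?_⟩
  simp_rw [hc]
  exact h3.mul_left _

end Descent

/-! ### Modular functions, and rho-functions against vanishing coset integrals -/

section Modular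

variable {G : Type*} [Group G] [TopologicalSpace G] [IsTopologicalGroup G] [LocallyCompactSpace G]

theorem modularFunction_pos (x : G) : 0 < modularFunction G x := by
  have : Measure.modularCharacter x ≠ 0 := (Measure.modularCharacterFun_pos x).ne'
  simpa [modularFunction, pos_iff_ne_zero] using this

theorem modularFunction_mul (x y : G) :
    modularFunction G (x * y) = modularFunction G x * modularFunction G y := by
  simp [modularFunction, mul_comm]

theorem modularFunction_inv (x : G) : modularFunction G x⁻¹ = (modularFunction G x)⁻¹ := by
  refine eq_inv_of_mul_eq_one_left ?_
  rw [← modularFunction_mul]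
  simp [modularFunction]

/-- The defining identity exhibits Δ as a constant divided by the continuous, nowhere vanishing
function x ↦ ∫ φ(yx) dy. -/
theorem continuous_modularFunction [T2Space G] : Continuous (modularFunction G) := by
  borelize G
  obtain ⟨φ, hφc, hφ0, hφ1⟩ := exists_continuous_nonneg_pos (1 : G)
  have hpos : 0 < ∫ y, φ y ∂(Measure.haar : Measure G) :=
    φ.continuous.integral_pos_of_hasCompactSupport_nonneg_nonzero hφc hφ0 hφ1
  have h : ∀ x, ∫ y, φ y ∂(Measure.haar : Measure G) =
      modularFunction G x * ∫ y, φ (y * x) ∂(Measure.haar : Measure G) :=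
    integral_eq_modularFunction_mul Measure.haar ⟨φ, hφc⟩
  have hne : ∀ x, ∫ y, φ (y * x) ∂(Measure.haar : Measure G) ≠ 0 := fun x h0 => by
    have := h x
    rw [h0, mul_zero] at this
    exact hpos.ne' this
  have hcont : Continuous fun x => ∫ y, φ (y * x) ∂(Measure.haar : Measure G) := by
    refine continuous_integral_of_locally_compact_support (f := fun x y => φ (y * x))
      (by fun_prop) fun K hK => ⟨tsupport φ * K⁻¹, hφc.isCompact.mul hK.inv, fun x hx y hy => ?_⟩
    by_contra h
    exact hy ⟨y * x, subset_tsupport _ h, x⁻¹, by simpa using hx, by simp⟩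
  refine ((continuous_const (y := ∫ y, φ y ∂(Measure.haar : Measure G))).div hcont hne).congr
    fun x => ?_
  exact (div_eq_iff (hne x)).2 (h x)

variable [MeasurableSpace G] [BorelSpace G]

/-- For regular μ the modular identity holds between measures, hence for arbitrary `F`; it is needed
for integrands containing ρ. -/
theorem integral_mul_right_eq (μ : Measure G) [μ.IsHaarMeasure] [μ.Regular] (F : G → ℝ) (x : G) :
    ∫ y, F (y * x) ∂μ = (modularFunction G x)⁻¹ * ∫ y, F y ∂μ := by
  haveI : (Measure.map (· * x) μ).Regular := Measure.Regular.map (Homeomorph.mulRight x)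
  have h := integral_map_equiv (μ := μ) (MeasurableEquiv.mulRight x) F
  have hm : Measure.map (MeasurableEquiv.mulRight x) μ = Measure.modularCharacterFun x • μ := by
    rw [Measure.modularCharacterFun_eq_haarScalarFactor μ x]
    exact Measure.isMulLeftInvariant_eq_smul_of_regular (Measure.map (· * x) μ) μ
  rw [hm, integral_smul_nnreal_measure] at h
  refine h.symm.trans ?_
  simp [modularFunction, Measure.modularCharacter, NNReal.smul_def]

/-- Inversion turns left Haar measure, weighted by the inverse of the modular function, into a
left invariant functional. -/
theorem exists_integral_inv_eq [T2Space G] (μ : Measure G) [μ.IsHaarMeasure] [μ.Regular] :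
    ∃ c : ℝ≥0, ∀ χ : C_c(G, ℝ),
      ∫ x, (modularFunction G x)⁻¹ * χ x⁻¹ ∂μ = c * ∫ x, χ x ∂μ := by
  have hint : ∀ χ : C_c(G, ℝ), Integrable (fun x => (modularFunction G x)⁻¹ * χ x⁻¹) μ := fun χ => by
    refine Continuous.integrable_of_hasCompactSupport ?_ ?_
    · exact (continuous_modularFunction.inv₀ fun x => (modularFunction_pos x).ne').mul
        ((map_continuous χ).comp continuous_inv)
    · exact (χ.hasCompactSupport.comp_homeomorph (Homeomorph.inv G)).mul_left
  refine exists_eq_mul_integral_of_translateLeft μ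
    (fun χ => ∫ x, (modularFunction G x)⁻¹ * χ x⁻¹ ∂μ) (fun χ ψ => ?_) (fun c χ => ?_)
    (fun χ hχ => integral_nonneg fun x => mul_nonneg (inv_nonneg.2 (modularFunction_pos x).le)
      (hχ _)) fun k χ => ?_
  · rw [← integral_add (hint χ) (hint ψ)]
    simp [mul_add]
  · rw [← integral_const_mul]
    simp [mul_left_comm]
  · have h := integral_mul_right_eq μ (fun x => (modularFunction G x)⁻¹ * χ x⁻¹) k⁻¹
    simp only [modularFunction_mul, modularFunction_inv, mul_inv, inv_inv, mul_inv_rev] at h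
    refine mul_left_cancel₀ (modularFunction_pos k).ne' (Eq.trans ?_ h)
    rw [← integral_const_mul]
    refine integral_congr_ae (Eventually.of_forall fun x => ?_)
    simp only [translateLeft_apply]
    ring

/-- Integration against a non-negative locally integrable density, as a Radon measure. -/
theorem exists_regular_integral_eq [T2Space G] (μ : Measure G) [IsFiniteMeasureOnCompacts μ]
    {ρ : G → ℝ} (h0 : ∀ x, 0 ≤ ρ x) (hρ : LocallyIntegrable ρ μ) :
    ∃ σ : Measure G, σ.Regular ∧ ∀ φ : C_c(G, ℝ), ∫ x, φ x ∂σ = ∫ x, ρ x * φ x ∂μ := by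
  have hint : ∀ φ : C_c(G, ℝ), Integrable (fun x => ρ x * φ x) μ := fun φ =>
    hρ.integrable_smul_right_of_hasCompactSupport (map_continuous φ) φ.hasCompactSupport
  let Λ : C_c(G, ℝ) →ₚ[ℝ] ℝ := PositiveLinearMap.mk₀
    { toFun := fun φ => ∫ x, ρ x * φ x ∂μ
      map_add' := fun φ ψ => by
        rw [← integral_add (hint φ) (hint ψ)]
        simp [mul_add]
      map_smul' := fun c φ => by
        simp only [RingHom.id_apply, smul_eq_mul]
        rw [← integral_const_mul]
        simp [mul_left_comm] }
    fun φ hφ => integral_nonneg fun x => mul_nonneg (h0 x) (hφ x)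
  exact ⟨RealRMK.rieszMeasure Λ, inferInstance, RealRMK.integral_rieszMeasure Λ⟩

/-- A rho-function integrates to zero against functions whose integrals over all cosets of `H`
vanish. -/
theorem IsRhoFunction.integral_mul_eq_zero [T2Space G] {H : Subgroup G}
    {hH : IsClosed (H : Set G)} {ρ : G → ℝ} (hρ : IsRhoFunction H hH ρ)
    (θ : Measure H) [θ.IsHaarMeasure] [θ.Regular] (φ : C_c(G, ℝ))
    (hφ : ∀ x : G, ∫ h : H, φ (x * h) ∂θ = 0) :
    ∫ x, ρ x * φ x ∂(Measure.haar : Measure G) = 0 := by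
  haveI : LocallyCompactSpace H := hH.isClosedEmbedding_subtypeVal.locallyCompactSpace
  obtain ⟨σ, hσr, hσ⟩ := exists_regular_integral_eq Measure.haar hρ.nonneg hρ.locallyIntegrable
  obtain ⟨g, -, hg⟩ := exists_fiberIntegral_eq_one θ hH φ.hasCompactSupport
  obtain ⟨c, hc⟩ := exists_integral_inv_eq θ
  have hΔ : Continuous fun h : H => (modularFunction H h)⁻¹ :=
    continuous_modularFunction.inv₀ fun x => (modularFunction_pos x).ne'
  have hφc := map_continuous φ
  have hgc := map_continuous g
  -- This set contains every h with x ∈ supp φ and xh ∈ supp g. It serves both before and after the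
  -- substitution y = xh.
  have hK : IsCompact (Subtype.val ⁻¹' ((tsupport φ)⁻¹ * tsupport g) : Set H) :=
    hH.isClosedEmbedding_subtypeVal.isCompact_preimage
      (φ.hasCompactSupport.isCompact.inv.mul g.hasCompactSupport)
  have hsupp : HasCompactSupport (Function.uncurry fun (x : G) (h : H) => φ x * g (x * h)) := by
    refine HasCompactSupport.intro (φ.hasCompactSupport.isCompact.prod hK) ?_
    rintro ⟨x, h⟩ hx
    by_contra hne
    obtain ⟨h1, h2⟩ := mul_ne_zero_iff.1 hne
    exact hx ⟨subset_tsupport _ h1, x⁻¹, by simpa using subset_tsupport _ h1, x * h,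
      subset_tsupport _ h2, by simp⟩
  have hsupp' : HasCompactSupport (Function.uncurry fun (y : G) (h : H) =>
      g y * ((modularFunction H h)⁻¹ * φ (y * (h : G)⁻¹))) := by
    refine HasCompactSupport.intro (g.hasCompactSupport.isCompact.prod hK) ?_
    rintro ⟨y, h⟩ hy
    by_contra hne
    obtain ⟨h1, h2⟩ := mul_ne_zero_iff.1 hne
    have h3 := (mul_ne_zero_iff.1 h2).2
    exact hy ⟨subset_tsupport _ h1, (y * (h : G)⁻¹)⁻¹, by simpa using subset_tsupport _ h3, y,
      subset_tsupport _ h1, by simp⟩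
  -- Substitute x = yh⁻¹: right translation gives Δ_G(h)⁻¹, which cancels the Δ_G(h) in ρ(yh⁻¹) =
  -- Δ_H(h)⁻¹ Δ_G(h) ρ(y).
  have hinner : ∀ h : H, ∫ x, φ x * g (x * h) ∂σ =
      ∫ y, g y * ((modularFunction H h)⁻¹ * φ (y * (h : G)⁻¹)) ∂σ := by
    intro h
    have e1 := hσ ⟨⟨fun x => φ x * g (x * h), by fun_prop⟩, φ.hasCompactSupport.mul_right⟩
    have e2 := hσ ⟨⟨fun y => g y * ((modularFunction H h)⁻¹ * φ (y * (h : G)⁻¹)), by fun_prop⟩,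
      g.hasCompactSupport.mul_right⟩
    refine e1.trans (Eq.trans ?_ e2.symm)
    have e3 := integral_mul_right_eq (Measure.haar : Measure G)
      (fun y => ρ (y * (h : G)⁻¹) * (φ (y * (h : G)⁻¹) * g y)) h
    simp only [mul_inv_cancel_right] at e3
    refine e3.trans ?_
    rw [← integral_const_mul]
    refine integral_congr_ae (Eventually.of_forall fun y => ?_)
    have e4 := hρ.map_mul y h⁻¹
    have e5 : subgroupModularFunction H hH h⁻¹ = (modularFunction H h)⁻¹ := modularFunction_inv h
    rw [e5, Subgroup.coe_inv, modularFunction_inv, inv_inv] at e4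
    have e6 := (modularFunction_pos (h : G)).ne'
    simp only [CompactlySupportedContinuousMap.coe_mk, ContinuousMap.coe_mk, e4]
    field_simp
  calc ∫ x, ρ x * φ x ∂(Measure.haar : Measure G)
      = ∫ x, φ x ∂σ := (hσ φ).symm
    _ = ∫ x, ∫ h : H, φ x * g (x * h) ∂θ ∂σ := by
        refine integral_congr_ae (Eventually.of_forall fun x => ?_)
        simp only [integral_const_mul]
        by_cases hx : φ x = 0
        · simp [hx]
        · have := hg x (subset_tsupport _ hx)
          rw [fiberIntegral_mk] at this
          rw [this, mul_one]
    _ = ∫ h : H, ∫ x, φ x * g (x * h) ∂σ ∂θ :=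
        integral_integral_swap_of_hasCompactSupport (by fun_prop) hsupp
    _ = ∫ h : H, ∫ y, g y * ((modularFunction H h)⁻¹ * φ (y * (h : G)⁻¹)) ∂σ ∂θ := by
        simp_rw [hinner]
    _ = ∫ y, ∫ h : H, g y * ((modularFunction H h)⁻¹ * φ (y * (h : G)⁻¹)) ∂θ ∂σ :=
        (integral_integral_swap_of_hasCompactSupport ((hgc.comp continuous_fst).mul
          ((hΔ.comp continuous_snd).mul (hφc.comp (by fun_prop)))) hsupp').symm
    _ = 0 := by
        refine integral_eq_zero_of_ae (Eventually.of_forall fun y => ?_)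
        have := hc (restrictCoset hH φ y)
        simp only [restrictCoset_apply, Subgroup.coe_inv, hφ, mul_zero] at this
        simp [integral_const_mul, this]

end Modular

/-! ### Lifting from `G/L` to `G`, and nonvanishing of Weil's constant -/

section

variable {G : Type*} [Group G] [TopologicalSpace G] [IsTopologicalGroup G]
  [T2Space G] [LocallyCompactSpace G] [MeasurableSpace G] [BorelSpace G]

/-- Every compactly supported continuous function `f` on `G/L` is the fibre integral of
`x ↦ f(xL) ψ(x)` for a suitable compactly supported continuous function `ψ` on `G`. -/
theorem exists_mul_fiberIntegral_eq {L : Subgroup G} (hL : IsClosed (L : Set G)) (κ : Measure L)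
    [κ.IsHaarMeasure] (f : C_c(G ⧸ L, ℝ)) :
    ∃ ψ : C_c(G, ℝ), ∀ q, f q * fiberIntegral L κ ψ q = f q := by
  obtain ⟨K, hK, hfK⟩ := exists_isCompact_image_mk_superset f.hasCompactSupport.isCompact
  obtain ⟨ψ, -, hψ⟩ := exists_fiberIntegral_eq_one κ hL hK
  refine ⟨ψ, fun q => ?_⟩
  by_cases hq : f q = 0
  · simp [hq]
  · obtain ⟨x, hx, rfl⟩ := hfK (subset_tsupport _ hq)
    rw [hψ x hx, mul_one]

/-- The function `x ↦ f(xL) ψ(x)` on `G`. -/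
def pullbackMul {L : Subgroup G} (f : C_c(G ⧸ L, ℝ)) (ψ : C_c(G, ℝ)) : C_c(G, ℝ) where
  toFun x := f x * ψ x
  continuous_toFun :=
    ((map_continuous f).comp QuotientGroup.continuous_mk).mul (map_continuous ψ)
  hasCompactSupport' := ψ.hasCompactSupport.mul_left

@[simp] theorem pullbackMul_apply {L : Subgroup G} (f : C_c(G ⧸ L, ℝ)) (ψ : C_c(G, ℝ)) (x : G) :
    pullbackMul f ψ x = f x * ψ x := rfl

/-- The constant in Weil's formula for a nonzero measure is nonzero. -/
theorem ne_zero_of_integral_fiberIntegral_eq {L : Subgroup G} (hL : IsClosed (L : Set G))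
    (κ : Measure L) [κ.IsHaarMeasure] [MeasurableSpace (G ⧸ L)] [BorelSpace (G ⧸ L)]
    {ν : Measure (G ⧸ L)} [ν.Regular] (hν : ν ≠ 0) {μ : Measure G} {c : ℝ≥0}
    (hc : ∀ φ : C_c(G, ℝ), ∫ q, fiberIntegral L κ φ q ∂ν = c * ∫ x, φ x ∂μ) : c ≠ 0 := by
  haveI := hL
  rintro rfl
  -- A nonzero regular measure charges some compact `C`. A cutoff with fibre integral at least 1_C
  -- then has positive integral over `G/L`, which c = 0 forbids.
  obtain ⟨C, -, hC, hC0⟩ := isOpen_univ.exists_lt_isCompact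
    (pos_iff_ne_zero.2 fun h => hν (Measure.measure_univ_eq_zero.1 h))
  obtain ⟨K, hK, hCK⟩ := exists_isCompact_image_mk_superset hC
  obtain ⟨ψ, hψ0, hψ⟩ := exists_fiberIntegral_eq_one κ hL hK
  have hle : ∫ q, C.indicator 1 q ∂ν ≤ ∫ q, fiberIntegral L κ ψ q ∂ν := by
    refine integral_mono ((integrable_indicator_iff hC.measurableSet).2
      (integrableOn_const hC.measure_ne_top)) (integrable_fiberIntegral hL κ ψ) fun q => ?_
    by_cases hq : q ∈ C
    · obtain ⟨x, hx, rfl⟩ := hCK hq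
      simp only [indicator_of_mem hq, Pi.one_apply]
      exact (hψ x hx).ge
    · simpa only [indicator_of_notMem hq] using fiberIntegral_nonneg κ hψ0 q
  rw [integral_indicator_one hC.measurableSet, hc, NNReal.coe_zero, zero_mul] at hle
  exact hle.not_gt (ENNReal.toReal_pos hC0.ne' hC.measure_ne_top)

end

/-! ### The tower L ≤ H ≤ G -/

section Tower

variable {G : Type*} [Group G] [TopologicalSpace G]

/-- For `L ≤ H`, the subgroup `L` of `G` is isomorphic to `L` as a subgroup of `H`. -/
def equivSubgroupOf {H L : Subgroup G} (hLH : L ≤ H) : L ≃ₜ* L.subgroupOf H where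
  __ := (Subgroup.subgroupOfEquivOfLe hLH).symm
  continuous_toFun := by
    refine Continuous.subtype_mk (Continuous.subtype_mk continuous_subtype_val _) _
  continuous_invFun := by
    refine Continuous.subtype_mk (continuous_subtype_val.comp continuous_subtype_val) _

variable [IsTopologicalGroup G] [T2Space G] [LocallyCompactSpace G] [MeasurableSpace G]
  [BorelSpace G] {H L : Subgroup G}

/-- Restricting to the fibre xH/L commutes with integrating over `L`; this makes Weil's formula on
`H/L` applicable to functions on `G`. -/
theorem fiberIntegral_fiberMap (hH : IsClosed (H : Set G)) (hLH : L ≤ H) (κ : Measure L)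
    [κ.IsHaarMeasure] (φ : C_c(G, ℝ)) (x : G) (q : H ⧸ L.subgroupOf H) :
    fiberIntegral L κ φ (fiberMap H L x q) =
      fiberIntegral (L.subgroupOf H) (κ.map (equivSubgroupOf hLH)) (restrictCoset hH φ x) q := by
  induction q using QuotientGroup.induction_on with
  | H h =>
    have := (equivSubgroupOf hLH).toHomeomorph.measurableEmbedding.integral_map (μ := κ)
      fun l => φ (x * ((h * (l : H) : H) : G))
    rw [fiberMap_mk, fiberIntegral_mk, fiberIntegral_mk]
    refine Eq.trans ?_ this.symm
    refine integral_congr_ae (Eventually.of_forall fun l => ?_)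
    exact congrArg φ (mul_assoc x h l)

variable [MeasurableSpace (H ⧸ L.subgroupOf H)] [BorelSpace (H ⧸ L.subgroupOf H)]
  (η : Measure (H ⧸ L.subgroupOf H)) [η.Regular]

/-- On the fibre through xH, `f` is the fibre integral of a function in C_c(H), hence continuous
with compact support. -/
theorem integrable_comp_fiberMap (hH : IsClosed (H : Set G)) (hL : IsClosed (L : Set G))
    (hLH : L ≤ H) (f : C_c(G ⧸ L, ℝ)) (x : G) :
    Integrable (fun q => f (fiberMap H L x q)) η := by
  haveI : LocallyCompactSpace H := hH.isClosedEmbedding_subtypeVal.locallyCompactSpace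
  haveI : LocallyCompactSpace L := hL.isClosedEmbedding_subtypeVal.locallyCompactSpace
  have hL' : IsClosed (L.subgroupOf H : Set H) := hL.preimage continuous_subtype_val
  obtain ⟨ψ, hψ⟩ := exists_mul_fiberIntegral_eq hL Measure.haar f
  have h := fun q => (fiberIntegral_fiberMap hH hLH Measure.haar (pullbackMul f ψ) x q).symm.trans
    ((fiberIntegral_mul_right Measure.haar ψ f _).trans (hψ _))
  exact (integrable_fiberIntegral hL' _ _).congr (Eventually.of_forall h)

variable [SMulInvariantMeasure H (H ⧸ L.subgroupOf H) η]

/-- If the integrals of `f` over the fibres of `G/L → G/H` vanish, then so do the integrals over the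
cosets of `H` of a function on `G` whose fibre integral is `f`. -/
theorem integral_coset_pullbackMul_eq_zero (hH : IsClosed (H : Set G))
    (hL : IsClosed (L : Set G)) (hLH : L ≤ H) (hη : η ≠ 0) (κ : Measure L) [κ.IsHaarMeasure]
    (θ : Measure H) [θ.IsHaarMeasure] (f : C_c(G ⧸ L, ℝ))
    (hf : ∀ x, ∫ q, f (fiberMap H L x q) ∂η = 0) (ψ : C_c(G, ℝ))
    (hψ : ∀ q, f q * fiberIntegral L κ ψ q = f q) (x : G) :
    ∫ h : H, pullbackMul f ψ (x * h) ∂θ = 0 := by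
  haveI : LocallyCompactSpace H := hH.isClosedEmbedding_subtypeVal.locallyCompactSpace
  have hL' : IsClosed (L.subgroupOf H : Set H) := hL.preimage continuous_subtype_val
  obtain ⟨c, hc⟩ := exists_integral_fiberIntegral_eq hL' (κ.map (equivSubgroupOf hLH)) η θ
  have hc0 : c ≠ 0 := ne_zero_of_integral_fiberIntegral_eq hL' _ hη hc
  have h1 := hc (restrictCoset hH (pullbackMul f ψ) x)
  have h2 := fun q => (fiberIntegral_fiberMap hH hLH κ (pullbackMul f ψ) x q).symm.trans
    ((fiberIntegral_mul_right κ ψ f _).trans (hψ _))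
  rw [integral_congr_ae (Eventually.of_forall h2), hf] at h1
  exact (mul_eq_zero.1 h1.symm).resolve_left (NNReal.coe_ne_zero.2 hc0)

variable [MeasurableSpace (G ⧸ L)] [BorelSpace (G ⧸ L)]

/-- The real-valued case of the theorem, where both Weil formulas and the annihilation property of ρ
are combined. -/
theorem integrable_onQuotient_mul (hH : IsClosed (H : Set G)) (hL : IsClosed (L : Set G))
    (hLH : L ≤ H) {ρ : G → ℝ} (hρ : IsRhoFunction H hH ρ)
    (ν : Measure (G ⧸ L)) [ν.Regular] [SMulInvariantMeasure G (G ⧸ L) ν] (hη : η ≠ 0)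
    (r : G ⧸ L → ℝ) (hr : ∀ x : G, r x = ρ x)
    (f : C_c(G ⧸ L, ℝ)) (hf : ∀ x, ∫ q, f (fiberMap H L x q) ∂η = 0) :
    Integrable (fun q => r q * f q) ν ∧ ∫ q, r q * f q ∂ν = 0 := by
  haveI : LocallyCompactSpace H := hH.isClosedEmbedding_subtypeVal.locallyCompactSpace
  haveI : LocallyCompactSpace L := hL.isClosedEmbedding_subtypeVal.locallyCompactSpace
  obtain ⟨c, hc⟩ := exists_integral_fiberIntegral_eq hL (Measure.haar : Measure L) ν
    (Measure.haar : Measure G)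
  obtain ⟨ψ, hψ⟩ := exists_mul_fiberIntegral_eq hL (Measure.haar : Measure L) f
  have hint : Integrable (fun x : G => ψ x * r x) (Measure.haar : Measure G) := by
    have h : Integrable (fun x : G => ψ x • ρ x) (Measure.haar : Measure G) :=
      hρ.locallyIntegrable.integrable_smul_left_of_hasCompactSupport (map_continuous ψ)
        ψ.hasCompactSupport
    exact h.congr (ae_of_all _ fun x => congrArg (ψ x * ·) (hr x).symm)
  have heq : ∀ q, f q * (r q * fiberIntegral L Measure.haar ψ q) = r q * f q := fun q => by
    rw [mul_left_comm, hψ]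
  obtain ⟨h1, h2⟩ := integrable_mul_fiberIntegral hL _ hc r ψ hint f
  simp_rw [heq] at h1 h2
  refine ⟨h1, h2.trans ?_⟩
  have h3 := hρ.integral_mul_eq_zero Measure.haar (pullbackMul f ψ)
    (integral_coset_pullbackMul_eq_zero η hH hL hLH hη _ _ f hf ψ hψ)
  -- The integral over `G` vanishes, so the constant for ν may be zero, as it is when ν = 0.
  refine mul_eq_zero_of_right _ (Eq.trans ?_ h3)
  refine integral_congr_ae (Eventually.of_forall fun x => ?_)
  simp only [hr, pullbackMul_apply]
  ring

end Tower

end QuotientIntegral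

/-! ### The complex case, by real and imaginary parts -/

open QuotientIntegral
theorem corollary3p7 {G : Type*} [Group G] [TopologicalSpace G] [IsTopologicalGroup G]
    [T2Space G] [LocallyCompactSpace G] [MeasurableSpace G] [BorelSpace G]
    (H L : Subgroup G) (hH : IsClosed (H : Set G)) (hL : IsClosed (L : Set G)) (hLH : L ≤ H)
    [MeasurableSpace (G ⧸ L)] [BorelSpace (G ⧸ L)]
    [MeasurableSpace (H ⧸ L.subgroupOf H)] [BorelSpace (H ⧸ L.subgroupOf H)]
    (hΔGH : ∀ l : L, modularFunction G (l : G) =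
      subgroupModularFunction H hH ⟨(l : G), hLH l.2⟩)
    (hΔHL : ∀ l : L, subgroupModularFunction H hH ⟨(l : G), hLH l.2⟩ =
      subgroupModularFunction L hL l)
    (ρ : G → ℝ) (hρ : IsRhoFunction H hH ρ)
    (ν : Measure (G ⧸ L)) [ν.Regular] [SMulInvariantMeasure G (G ⧸ L) ν]
    (η : Measure (H ⧸ L.subgroupOf H)) [η.Regular]
    [SMulInvariantMeasure H (H ⧸ L.subgroupOf H) η] (hη : η ≠ 0)
    (f : C_c(G ⧸ L, ℂ)) (hf : radonTransform H L η f = 0) :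
    Integrable (fun q : G ⧸ L => (rhoQuotient hρ hLH hΔGH q : ℂ) * f q) ν ∧
      ∫ q : G ⧸ L, (rhoQuotient hρ hLH hΔGH q : ℂ) * f q ∂ν = 0 := by
  let f₁ : C_c(G ⧸ L, ℝ) := ⟨⟨fun q => (f q).re, by fun_prop⟩,
    f.hasCompactSupport.comp_left (g := Complex.re) rfl⟩
  let f₂ : C_c(G ⧸ L, ℝ) := ⟨⟨fun q => (f q).im, by fun_prop⟩,
    f.hasCompactSupport.comp_left (g := Complex.im) rfl⟩
  -- Integrability on the fibres lets real and imaginary parts pass under the integral, so both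
  -- parts of `f` have vanishing Radon transform.
  have hint : ∀ x, Integrable (fun q => f (fiberMap H L x q)) η := fun x =>
    Integrable.re_im_iff.1 ⟨integrable_comp_fiberMap η hH hL hLH f₁ x,
      integrable_comp_fiberMap η hH hL hLH f₂ x⟩
  have hf0 : ∀ x, ∫ q, f (fiberMap H L x q) ∂η = 0 := fun x => congrFun hf (x : G ⧸ H)
  obtain ⟨h1, h1'⟩ := integrable_onQuotient_mul η hH hL hLH hρ ν hη
    (rhoQuotient hρ hLH hΔGH) (fun _ => rfl) f₁ fun x =>
      (Complex.reCLM.integral_comp_comm (hint x)).trans (by rw [hf0 x, map_zero])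
  obtain ⟨h2, h2'⟩ := integrable_onQuotient_mul η hH hL hLH hρ ν hη
    (rhoQuotient hρ hLH hΔGH) (fun _ => rfl) f₂ fun x =>
      (Complex.imCLM.integral_comp_comm (hint x)).trans (by rw [hf0 x, map_zero])
  have hI : Integrable (fun q : G ⧸ L => (rhoQuotient hρ hLH hΔGH q : ℂ) * f q) ν :=
    Integrable.re_im_iff.1 ⟨h1.congr (ae_of_all _ fun q => (Complex.re_ofReal_mul _ _).symm),
      h2.congr (ae_of_all _ fun q => (Complex.im_ofReal_mul _ _).symm)⟩
  refine ⟨hI, Complex.ext ?_ ?_⟩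
  · have := Complex.reCLM.integral_comp_comm hI
    simp only [Complex.reCLM_apply, Complex.re_ofReal_mul] at this
    exact this.symm.trans h1'
  · have := Complex.imCLM.integral_comp_comm hI
    simp only [Complex.imCLM_apply, Complex.im_ofReal_mul] at this
    exact this.symm.trans h2'
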